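/- Theorem 3.1. Let $A$ be a complex Banach algebra with identity which is semisimple, i.e. whose Jacobson radical is $\{0\}$. For $x\in A$ let $\sigma(x)=\{\lambda\in\mathbb{C} : \lambda\mathbf{1}-x \text{ is not invertible in } A\}$ and $\rho(x)=\sup\{|\lambda| : \lambda\in\sigma(x)\}$ denote the spectrum and the spectral radius of $x$. Let $a,b\in A$. Then the following are equivalent: (i) $a=b$; (ii) $\rho(a+x)\le\rho(b+x)$ for all $x$ in some open neighbourhood of $-b$ in $A$. -/

import Mathlib

/-! Put `c = a - b`. The maximum principle for `s ↦ s • c + y` on a large circle turns the local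
bound into `ρ (c + y) ≤ ρ y` for every `y`. Hence `c` is quasinilpotent, and so is `c - u * c * u⁻¹`
for every unit `u`. If `c` lay outside a maximal left ideal `m`, some `z ∈ m` would satisfy `z * c ≡
1` mod `m`; then `u = 1 + t • z` with small `t ≠ 0` puts `-t` in the spectrum of that difference, a
contradiction. So `c` lies in the radical. -/

open Filter Topology in
/-- Maximum principle for the spectral radius of an entire Banach-algebra-valued function. -/
theorem spectralRadius_le_of_forall_sphere_lt {A : Type*} [NormedRing A] [NormedAlgebra ℂ A]
    [CompleteSpace A] {f : ℂ → A} (hf : Differentiable ℂ f) {r : ℝ} {K : NNReal}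
    (h : ∀ s ∈ Metric.sphere (0 : ℂ) r, spectralRadius ℂ (f s) < K)
    {w : ℂ} (hw : w ∈ Metric.ball (0 : ℂ) r) : spectralRadius ℂ (f w) ≤ K := by
  have hr : 0 < r := Metric.nonempty_ball.1 ⟨w, hw⟩
  have htwo : Tendsto (fun k : ℕ => 2 ^ k) atTop atTop :=
    tendsto_pow_atTop_atTop_of_one_lt one_lt_two
  -- Exponents `2 ^ k` make these sets increase with `k`, so compactness of the circle yields a
  -- single `k`.
  let V : ℕ → Set ℂ := fun k => {s | ‖f s ^ 2 ^ k‖ < (K : ℝ) ^ 2 ^ k}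
  have hVo (k : ℕ) : IsOpen (V k) :=
    isOpen_lt (hf.continuous.pow _).norm continuous_const
  have hVm : Monotone V := by
    refine monotone_nat_of_le_succ fun k s hs => ?_
    simp only [V, Set.mem_ofPred_eq] at hs ⊢
    rw [pow_succ, pow_mul, pow_mul]
    calc ‖(f s ^ 2 ^ k) ^ 2‖ ≤ ‖f s ^ 2 ^ k‖ ^ 2 := norm_pow_le' _ two_pos
      _ < ((K : ℝ) ^ 2 ^ k) ^ 2 := by gcongr
  have hcover : Metric.sphere (0 : ℂ) r ⊆ ⋃ k, V k := by
    intro s hs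
    have ht := ((spectrum.pow_nnnorm_pow_one_div_tendsto_nhds_spectralRadius (f s)).comp
      htwo).eventually (gt_mem_nhds (h s hs))
    obtain ⟨k, hk⟩ := ht.exists
    refine Set.mem_iUnion.2 ⟨k, ?_⟩
    have hpos : (0 : ℝ) < ((2 ^ k : ℕ) : ℝ) := by positivity
    simp only [Function.comp_apply, one_div] at hk
    rw [ENNReal.rpow_inv_lt_iff hpos, ENNReal.rpow_natCast] at hk
    exact_mod_cast hk
  obtain ⟨k, hk⟩ := (isCompact_sphere (0 : ℂ) r).elim_directed_cover V hVo hcover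
    hVm.directed_le
  refine le_of_tendsto
    ((spectrum.pow_nnnorm_pow_one_div_tendsto_nhds_spectralRadius (f w)).comp htwo) ?_
  filter_upwards [eventually_ge_atTop k] with j hj
  have hbound : ‖f w ^ 2 ^ j‖ ≤ (K : ℝ) ^ 2 ^ j := by
    refine Complex.norm_le_of_forall_mem_frontier_norm_le (f := fun s => f s ^ 2 ^ j)
      (U := Metric.ball (0 : ℂ) r) Metric.isBounded_ball
      (hf.pow _).diffContOnCl (fun s hs => ?_) (subset_closure hw)
    rw [frontier_ball (0 : ℂ) hr.ne'] at hs
    exact (hVm hj (hk hs)).le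
  have hpos : (0 : ℝ) < ((2 ^ j : ℕ) : ℝ) := by positivity
  simp only [Function.comp_apply, one_div]
  rw [ENNReal.rpow_inv_le_iff hpos, ENNReal.rpow_natCast]
  exact_mod_cast hbound

theorem spectralRadius_smul_le {A : Type*} [NormedRing A] [NormedAlgebra ℂ A]
    {t : ℂ} (ht : t ≠ 0) (x : A) :
    spectralRadius ℂ (t • x) ≤ ‖t‖₊ * spectralRadius ℂ x := by
  refine iSup₂_le fun s hs => ?_
  have h := spectrum.unit_smul_eq_smul x (Units.mk0 t ht)
  rw [Units.smul_def, Units.val_mk0] at h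
  rw [h] at hs
  obtain ⟨q, hq, rfl⟩ := hs
  simp only [Units.val_mk0, smul_eq_mul, nnnorm_mul, ENNReal.coe_mul]
  gcongr
  exact le_iSup₂ (f := fun k (_ : k ∈ spectrum ℂ x) => (‖k‖₊ : ENNReal)) q hq

/-- A spectral radius inequality `ρ (c + y) ≤ ρ y` near zero holds globally. -/
theorem spectralRadius_add_le_of_eventually {A : Type*} [NormedRing A] [NormedAlgebra ℂ A]
    [CompleteSpace A] {c : A}
    (hc : ∀ᶠ y in nhds (0 : A), spectralRadius ℂ (c + y) ≤ spectralRadius ℂ y) (y : A) :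
    spectralRadius ℂ (c + y) ≤ spectralRadius ℂ y := by
  refine ENNReal.le_of_forall_pos_le_add fun ε hε hy => ?_
  lift spectralRadius ℂ y to NNReal using hy.ne with K hK
  obtain ⟨δ, hδ, hball⟩ := Metric.eventually_nhds_iff.1 hc
  -- `r > 1` puts `1` inside the circle; `r > ‖y‖ / δ` puts `s⁻¹ • y` within `δ` of `0`.
  obtain ⟨r, hr⟩ := exists_gt (max 1 (‖y‖ / δ))
  have hr1 : 1 < r := (le_max_left _ _).trans_lt hr
  have hr2 : ‖y‖ / δ < r := (le_max_right _ _).trans_lt hr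
  have hmax := spectralRadius_le_of_forall_sphere_lt (f := fun s : ℂ => s • c + y)
    (by fun_prop) (r := r) (K := K + ε) (fun s hs => ?_) (w := 1) (by simpa using hr1)
  · simpa using hmax
  have hsr : ‖s‖ = r := by simpa using hs
  have hs0 : s ≠ 0 := norm_pos_iff.1 (by linarith)
  have hsmall : dist (s⁻¹ • y) 0 < δ := by
    rw [dist_zero_right, norm_smul, norm_inv, hsr, inv_mul_lt_iff₀ (by linarith)]
    rwa [div_lt_iff₀ hδ] at hr2
  have hne : (‖s‖₊ : ENNReal) ≠ 0 := by simpa using hs0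
  calc spectralRadius ℂ (s • c + y) = spectralRadius ℂ (s • (c + s⁻¹ • y)) := by
        rw [smul_add, smul_inv_smul₀ hs0]
    _ ≤ ‖s‖₊ * spectralRadius ℂ (c + s⁻¹ • y) := spectralRadius_smul_le hs0 _
    _ ≤ ‖s‖₊ * spectralRadius ℂ (s⁻¹ • y) := by gcongr; exact hball hsmall
    _ ≤ ‖s‖₊ * (‖s⁻¹‖₊ * spectralRadius ℂ y) := by
        gcongr; exact spectralRadius_smul_le (inv_ne_zero hs0) _
    _ = K := by
        rw [← mul_assoc, ← ENNReal.coe_mul, ← nnnorm_mul, mul_inv_cancel₀ hs0, nnnorm_one,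
          ENNReal.coe_one, one_mul, hK]
    _ < (K + ε : NNReal) := by exact_mod_cast lt_add_of_pos_right K hε

-- The norms `‖c ^ n‖` decay faster than any geometric sequence, which beats the growth of `‖b ^
-- n‖`.
open Filter Topology in
theorem tendsto_pow_mul_pow_of_spectralRadius_eq_zero {A : Type*} [NormedRing A]
    [NormedAlgebra ℂ A] [CompleteSpace A] {c : A} (hc : spectralRadius ℂ c = 0) (b : A) :
    Tendsto (fun n : ℕ => b ^ n * c ^ n) atTop (𝓝 0) := by
  have hB : 0 < ‖b‖ + 1 := by positivity
  let ε : NNReal := ⟨(2 * (‖b‖ + 1))⁻¹, by positivity⟩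
  have hε : 0 < ε := by
    have : (0 : ℝ) < (2 * (‖b‖ + 1))⁻¹ := by positivity
    exact_mod_cast this
  have ht := (spectrum.pow_nnnorm_pow_one_div_tendsto_nhds_spectralRadius c).eventually
    (gt_mem_nhds (hc.trans_lt (ENNReal.coe_pos.2 hε)))
  refine squeeze_zero_norm' ?_ (tendsto_pow_atTop_nhds_zero_of_lt_one
    (r := (1 / 2 : ℝ)) (by norm_num) (by norm_num))
  filter_upwards [ht, eventually_gt_atTop 0] with n hn hn0
  have hpos : (0 : ℝ) < (n : ℝ) := by exact_mod_cast hn0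
  rw [one_div, ENNReal.rpow_inv_lt_iff hpos, ENNReal.rpow_natCast] at hn
  have hn' : ‖c ^ n‖ < (ε : ℝ) ^ n := by exact_mod_cast hn
  have hε' : (ε : ℝ) = (2 * (‖b‖ + 1))⁻¹ := rfl
  calc ‖b ^ n * c ^ n‖ ≤ ‖b ^ n‖ * ‖c ^ n‖ := norm_mul_le _ _
    _ ≤ (‖b‖ + 1) ^ n * (ε : ℝ) ^ n := by
        gcongr
        exact (norm_pow_le' b hn0).trans (by gcongr; linarith)
    _ = (1 / 2) ^ n := by rw [← mul_pow, hε']; congr 1; field_simp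

/-- Units form an open set, so the closure of `m` is still a proper left ideal. -/
theorem Ideal.IsMaximal.isClosed_of_normedRing {A : Type*} [NormedRing A] [CompleteSpace A]
    {m : Ideal A} (hm : m.IsMaximal) : IsClosed (m : Set A) := by
  have hdisj : Disjoint (m : Set A) {x | IsUnit x} :=
    Set.disjoint_left.2 fun x hx hu => hm.ne_top (m.eq_top_of_isUnit_mem hx hu)
  have hcl : Disjoint (closure (m : Set A)) {x | IsUnit x} :=
    hdisj.closure_left Units.isOpen
  let M : Ideal A :=
    { m.toAddSubgroup.topologicalClosure.toAddSubmonoid with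
      smul_mem' := fun a x hx =>
        map_mem_closure (continuous_const.mul continuous_id) hx
          fun y hy => m.mul_mem_left a hy }
  have hM : (M : Set A) = closure (m : Set A) := rfl
  have hMtop : M ≠ ⊤ := fun h => by
    have h1 : (1 : A) ∈ (M : Set A) := by rw [h]; trivial
    exact Set.disjoint_left.1 hcl (hM ▸ h1) isUnit_one
  have hmM : m = M := hm.eq_of_le hMtop fun x hx => subset_closure hx
  refine isClosed_of_closure_subset fun x hx => ?_
  rw [hmM]
  exact hx

/-- For a quasinilpotent element outside a maximal left ideal `m`, there is an element of `m`
moving the class of that element to the class of `1`. -/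
theorem exists_mem_mul_sub_one_mem {A : Type*} [NormedRing A] [NormedAlgebra ℂ A]
    [CompleteSpace A] {c : A} (hc : spectralRadius ℂ c = 0) {m : Ideal A} (hm : m.IsMaximal)
    (hcm : c ∉ m) : ∃ z ∈ m, z * c - 1 ∈ m := by
  by_contra! hno
  have hone : ∀ J : Ideal A, m < J → (1 : A) ∈ J := fun J hJ => by
    rw [hm.1.2 J hJ]; trivial
  let R : A →ₗ[A] A := LinearMap.toSpanSingleton A A c
  -- Otherwise `m + m * c` is everything, and writing `1` in it produces the forbidden `z`.
  have hstable : ∀ x ∈ m, x * c ∈ m := by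
    by_contra! hx
    obtain ⟨x, hx, hxc⟩ := hx
    have hlt : m < m ⊔ Submodule.map R m := lt_of_le_of_ne le_sup_left fun h => hxc <| by
      rw [h]
      exact le_sup_right (a := m) (Submodule.mem_map.2 ⟨x, hx, rfl⟩)
    obtain ⟨p, hp, q, hq, hpq⟩ := Submodule.mem_sup.1 (hone _ hlt)
    obtain ⟨z, hz, rfl⟩ := Submodule.mem_map.1 hq
    refine hno z hz ?_
    have hzp : z * c - 1 = -p := by rw [← hpq]; simp [R]
    rw [hzp]
    exact m.neg_mem hp
  obtain ⟨b, hb⟩ : ∃ b, b * c - 1 ∈ m := by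
    have hlt : m < m ⊔ Ideal.span {c} := lt_of_le_of_ne le_sup_left fun h => hcm <| by
      rw [h]
      exact le_sup_right (a := m) (Ideal.mem_span_singleton_self c)
    obtain ⟨p, hp, q, hq, hpq⟩ := Submodule.mem_sup.1 (hone _ hlt)
    obtain ⟨b, rfl⟩ := Ideal.mem_span_singleton'.1 hq
    refine ⟨b, ?_⟩
    have hbp : b * c - 1 = -p := by rw [← hpq]; abel
    rw [hbp]
    exact m.neg_mem hp
  -- Right multiplication by `c` now acts on `A / m`, so `b * c ≡ 1` can be iterated; yet `b ^ n * c
  -- ^ n` tends to `0` and `m` is closed.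
  have hpow (n : ℕ) : b ^ n * c ^ n - 1 ∈ m := by
    induction n with
    | zero => simp
    | succ n ih =>
      have h := m.add_mem (hstable _ (m.mul_mem_left b ih)) hb
      convert h using 1
      rw [pow_succ' b, pow_succ c]
      noncomm_ring
  have hlim := (tendsto_pow_mul_pow_of_spectralRadius_eq_zero hc b).sub_const 1
  have hmem : (0 - 1 : A) ∈ (m : Set A) :=
    hm.isClosed_of_normedRing.mem_of_tendsto hlim (Filter.Eventually.of_forall hpow)
  refine hm.ne_top (m.eq_top_iff_one.2 ?_)
  simpa using m.neg_mem hmem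

/-- An element of a complex Banach algebra that does not increase spectral radii near zero
belongs to the Jacobson radical. -/
theorem mem_jacobson_of_eventually_spectralRadius_add_le {A : Type*} [NormedRing A]
    [NormedAlgebra ℂ A] [CompleteSpace A] {c : A}
    (hc : ∀ᶠ y in nhds (0 : A), spectralRadius ℂ (c + y) ≤ spectralRadius ℂ y) :
    c ∈ Ring.jacobson A := by
  have hall := spectralRadius_add_le_of_eventually hc
  have hc0 : spectralRadius ℂ c = 0 := by simpa using hall 0
  rw [Ring.jacobson_eq_sInf_isMaximal, Submodule.mem_sInf]
  intro (m : Ideal A) hm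
  by_contra hcm
  obtain ⟨z, hz, hzc⟩ := exists_mem_mul_sub_one_mem hc0 hm hcm
  obtain ⟨t, ht0, ht⟩ : ∃ t : ℂ, t ≠ 0 ∧ IsUnit (1 + t • z) := by
    have hcont : Continuous fun t : ℂ => (1 : A) + t • z := by fun_prop
    have hev : ∀ᶠ t in nhds (0 : ℂ), IsUnit (1 + t • z) :=
      (Units.isOpen.preimage hcont).mem_nhds (by simp)
    obtain ⟨t, ht, ht0⟩ := ((hev.filter_mono nhdsWithin_le_nhds).and
      (self_mem_nhdsWithin (a := (0 : ℂ)) (s := {0}ᶜ))).exists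
    exact ⟨t, ht0, ht⟩
  obtain ⟨u, hu⟩ := ht
  have hq : spectralRadius ℂ (c - u * c * ↑u⁻¹) = 0 := by
    have hneg : spectralRadius ℂ (-(u * c * ↑u⁻¹) : A) = 0 := by
      have h := spectralRadius_smul_le (t := -1) (by norm_num) (u * c * ↑u⁻¹ : A)
      have hconj : spectralRadius ℂ (u * c * ↑u⁻¹ : A) = 0 := by
        rw [spectralRadius, spectrum.units_conjugate]; exact hc0
      rw [hconj, mul_zero, nonpos_iff_eq_zero, neg_one_smul] at h
      exact h
    have h := hall (-(u * c * ↑u⁻¹))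
    rwa [hneg, nonpos_iff_eq_zero, ← sub_eq_add_neg] at h
  set d : A := c - u * c * ↑u⁻¹ with hd
  have hdu : d * u = t • (c * z - z * c) := by
    have h1 : d * u = c * u - u * c := by
      rw [hd, sub_mul, Units.inv_mul_cancel_right]
    rw [h1, hu, mul_add, add_mul, smul_mul_assoc, mul_smul_comm, smul_sub, mul_one, one_mul]
    abel
  -- Modulo `m`, `d ≡ d * u`, because `z ∈ m`, and `d * u ≡ -t • (z * c) ≡ -t`.
  have hdm : algebraMap ℂ A t + d ∈ m := by
    have heq : algebraMap ℂ A t + d =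
        algebraMap ℂ A t * (c * z) - algebraMap ℂ A t * (z * c - 1) -
          d * (algebraMap ℂ A t * z) := by
      have h2 : d = d * u - d * (algebraMap ℂ A t * z) := by
        rw [hu, ← Algebra.smul_def, mul_add, mul_one]; abel
      conv_lhs => rw [h2, hdu, Algebra.smul_def]
      noncomm_ring
    rw [heq]
    exact m.sub_mem (m.sub_mem (m.mul_mem_left _ (m.mul_mem_left _ hz)) (m.mul_mem_left _ hzc))
      (m.mul_mem_left _ (m.mul_mem_left _ hz))
  have hspec : -t ∈ spectrum ℂ d := by
    rw [spectrum.mem_iff]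
    intro hunit
    refine hm.ne_top (m.eq_top_of_isUnit_mem (m.neg_mem hdm) ?_)
    convert hunit using 1
    rw [map_neg]; abel
  have hle : (‖-t‖₊ : ENNReal) ≤ spectralRadius ℂ d :=
    le_iSup₂ (f := fun k (_ : k ∈ spectrum ℂ d) => (‖k‖₊ : ENNReal)) (-t) hspec
  rw [hq] at hle
  exact ht0 (by simpa using hle)

theorem theorem3p1 {A : Type*} [NormedRing A] [NormedAlgebra ℂ A] [CompleteSpace A]
    (hA : Ring.jacobson A = ⊥) (a b : A) :
    a = b ↔ ∃ U : Set A, IsOpen U ∧ -b ∈ U ∧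
      ∀ x ∈ U, spectralRadius ℂ (a + x) ≤ spectralRadius ℂ (b + x) := by
  constructor
  · rintro rfl
    exact ⟨Set.univ, isOpen_univ, trivial, fun _ _ => le_rfl⟩
  · rintro ⟨U, hU, hbU, h⟩
    have hmem : a - b ∈ Ring.jacobson A := by
      apply mem_jacobson_of_eventually_spectralRadius_add_le
      have hcont : Continuous fun y : A => y - b := by fun_prop
      filter_upwards [(hU.preimage hcont).mem_nhds (by simpa using hbU)] with y hy
      have := h _ hy
      rwa [add_sub_cancel, show a + (y - b) = a - b + y by abel] at this
    rw [hA] at hmem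
    exact sub_eq_zero.1 hmem
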